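/- Let $n\ge 2$ and let $\Omega\subset\mathbb{C}^n$ be a domain (open, connected, not necessarily bounded) with $C^1$ boundary. For $p\in\partial\Omega$ let $N_p$ be the unit outward normal vector, and call a vector $v\in\mathbb{C}^n$ complex tangential at $p$ if both $v$ and $iv$ are tangent to $\partial\Omega$ at $p$. Let $U\subset\partial\Omega$ be relatively compact and open in $\partial\Omega$, let $k\ge 1$ be an integer, and assume that $U$ satisfies the uniform disc property of index $k$ with constants $\delta_0,c_1,c_2>0$: for every $p\in U$, every complex tangential vector $L_p$ at $p$ with $|L_p|=1$, every $0<\delta\le\delta_0$ and all $w_1,w_2\in\mathbb{C}$ with $|w_1|\le c_1\delta$ and $|w_2|\le c_2\delta^{1/k}$, $$p-\delta N_p-w_1N_p+w_2L_p\in\Omega .$$ Let $0<\alpha<1/k$ and let $f:\Omega\to\mathbb{C}$ be holomorphic and Lipschitz of order $\alpha$ on $\Omega$, i.e. $|f(z)-f(w)|\le K|z-w|^\alpha$ for some constant $K$ and all $z,w\in\Omega$. Then there is a constant $C>0$ such that the following holds. Let $\pi$ be a normal projection, i.e. a map from an open neighborhood $V$ of $\partial\Omega$ to $\partial\Omega$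 with $|z-\pi(z)|=\operatorname{dist}(z,\partial\Omega)$ for all $z\in V$. Let $\gamma:[0,1]\to\Omega\cap V$ be a normalized complex tangential curve, i.e. a $C^2$ curve such that for all $t\in[0,1]$ one has $|\gamma'(t)|=1$ and $\gamma'(t)$ is complex tangential at $\pi(\gamma(t))$. If $\operatorname{dist}(\gamma(t),\partial\Omega)\le\delta_0/5$ and $\pi(\gamma(t))\in U$ for all $t\in[0,1]$, then $$|f(\gamma(s))-f(\gamma(t))|\le C\,|s-t|^{k\alpha}\qquad\text{for all } s,t\in[0,1].$$ The constant $C$ does not depend on $\gamma$, $s$, $t$, nor on the choice of $\pi$. -/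

import Mathlib

open Set Topology
open scoped NNReal ContDiff

/-- A local `C¹` defining function `r` of `Ω` near `p`: on some open neighbourhood `W` of `p` the
function `r` is real `C¹` and `Ω ∩ W = {r < 0}`, and `dr(p) ≠ 0`. -/
def IsLocalDefiningFunction {n : ℕ} (Ω : Set (EuclideanSpace ℂ (Fin n)))
    (p : EuclideanSpace ℂ (Fin n)) (r : EuclideanSpace ℂ (Fin n) → ℝ) : Prop :=
  ∃ W : Set (EuclideanSpace ℂ (Fin n)), IsOpen W ∧ p ∈ W ∧ ContDiffOn ℝ 1 r W ∧
    fderiv ℝ r p ≠ 0 ∧ Ω ∩ W = {q | q ∈ W ∧ r q < 0}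

/-- `Ω` has `C¹` boundary. -/
def HasC1Boundary {n : ℕ} (Ω : Set (EuclideanSpace ℂ (Fin n))) : Prop :=
  ∀ p ∈ frontier Ω, ∃ r : EuclideanSpace ℂ (Fin n) → ℝ, IsLocalDefiningFunction Ω p r

/-- `N` is the unit outward normal vector of `Ω` at `p`: `‖N‖ = 1` and the real gradient at `p`
of a local defining function (with respect to the real inner product `Re ⟨·,·⟩` of
`ℂⁿ = ℝ²ⁿ`) is a positive multiple of `N`. -/
def IsUnitOutwardNormal {n : ℕ} (Ω : Set (EuclideanSpace ℂ (Fin n)))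
    (p N : EuclideanSpace ℂ (Fin n)) : Prop :=
  ‖N‖ = 1 ∧ ∃ r : EuclideanSpace ℂ (Fin n) → ℝ, IsLocalDefiningFunction Ω p r ∧
    ∃ c : ℝ, 0 < c ∧ ∀ v : EuclideanSpace ℂ (Fin n), fderiv ℝ r p v = c * (inner ℂ N v).re

/-- `v` is complex tangential to `∂Ω` at `p`, i.e. it belongs to the maximal complex subspace
of the real tangent space `ker dr(p)`: both `v` and `i v` are tangent to `∂Ω` at `p`. -/
def IsComplexTangent {n : ℕ} (Ω : Set (EuclideanSpace ℂ (Fin n)))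
    (p v : EuclideanSpace ℂ (Fin n)) : Prop :=
  ∃ r : EuclideanSpace ℂ (Fin n) → ℝ, IsLocalDefiningFunction Ω p r ∧
    fderiv ℝ r p v = 0 ∧ fderiv ℝ r p (Complex.I • v) = 0

/-- `S ⊆ ∂Ω` satisfies the uniform disc property of index `k` with the constants
`δ₀, c₁, c₂ > 0`. -/
def UniformDiscPropertyWith {n : ℕ} (Ω S : Set (EuclideanSpace ℂ (Fin n))) (k : ℕ)
    (δ₀ c₁ c₂ : ℝ) : Prop :=
  0 < δ₀ ∧ 0 < c₁ ∧ 0 < c₂ ∧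
    ∀ p ∈ S, ∀ N L : EuclideanSpace ℂ (Fin n), IsUnitOutwardNormal Ω p N →
      IsComplexTangent Ω p L → ‖L‖ = 1 →
      ∀ δ : ℝ, 0 < δ → δ ≤ δ₀ → ∀ w₁ w₂ : ℂ, ‖w₁‖ ≤ c₁ * δ → ‖w₂‖ ≤ c₂ * δ ^ (1 / (k : ℝ)) →
        (p - (δ : ℂ) • N) - w₁ • N + w₂ • L ∈ Ω

/-- `π` is a normal (nearest point) projection onto `∂Ω`, defined on the neighbourhood `V`
of `∂Ω`. Values of `π` outside `V` are irrelevant. -/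
def IsNormalProjection {n : ℕ} (Ω V : Set (EuclideanSpace ℂ (Fin n)))
    (π : EuclideanSpace ℂ (Fin n) → EuclideanSpace ℂ (Fin n)) : Prop :=
  IsOpen V ∧ frontier Ω ⊆ V ∧
    ∀ z ∈ V, π z ∈ frontier Ω ∧ dist z (π z) = Metric.infDist z (frontier Ω)

/-- `γ : [0,1] → Ω` is a normalized complex tangential curve in `Ω` (with respect to the normal
projection `π`, in whose domain `V` the curve lies): it is `C²`, `|γ'| ≡ 1`, and `γ'(t)` is
complex tangential to `∂Ω` at `π (γ t)`. -/
def IsNormalizedComplexTangentialCurve {n : ℕ} (Ω V : Set (EuclideanSpace ℂ (Fin n)))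
    (π : EuclideanSpace ℂ (Fin n) → EuclideanSpace ℂ (Fin n))
    (γ : ℝ → EuclideanSpace ℂ (Fin n)) : Prop :=
  ContDiffOn ℝ 2 γ (Icc 0 1) ∧ ∀ t ∈ Icc (0 : ℝ) 1, γ t ∈ Ω ∧ γ t ∈ V ∧
    IsComplexTangent Ω (π (γ t)) (derivWithin γ (Icc 0 1) t) ∧
    ‖derivWithin γ (Icc 0 1) t‖ = 1

/-! The proof is a Hardy–Littlewood argument at depth `δ` below the curve. Put `κ = 1/k`. Cauchy's
estimate on one tangential disc of radius about `δ ^ κ`, with the Hölder bound on that disc, gives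
only `δ ^ (κ * (α - 1))` for the tangential derivative, which is too large. Instead,
`norm_deriv_line_le_of_discs` compares the discs at depths `δ` and `2δ`: the values of `f` there
differ by at most `K δ ^ α`, so the derivatives differ by `O(δ ^ (α - κ))`. Since `α < κ`, the
doublings sum geometrically, and the derivative itself is `O(δ ^ (α - κ))`.

For `h = |s - t|`, push the curve inward by `δ = h ^ k`. The push costs `K δ ^ α = K h ^ (kα)` at
each end, and integrating the derivative along the pushed arc costs `O(δ ^ (α - κ) * h) = O(h ^
(kα))`.

The push uses one fixed vector, the normal at the projection of `γ t`, so `π` is never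
differentiated and need not be continuous. Uniform continuity of the normal on `closure U` keeps
this vector close to the other normals, and `UniformDiscPropertyWith.mem_of_near_normal` absorbs the
error. Large `h` and curves far from the boundary are elementary. -/

/-! ### Defining functions, normals and complex tangents -/

/-- A functional that is nonpositive on the open half-space `l < 0` is a nonnegative multiple
of `l`. -/
theorem nonneg_multiple_of_halfspace {E : Type*} [AddCommGroup E] [Module ℝ E]
    (l m : E →ₗ[ℝ] ℝ) (hl : l ≠ 0) (h : ∀ v, l v < 0 → m v ≤ 0) :
    ∃ c : ℝ, 0 ≤ c ∧ ∀ v, m v = c * l v := by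
  obtain ⟨u, hu⟩ : ∃ u, l u = -1 := by
    obtain ⟨u, hu⟩ : ∃ u, l u ≠ 0 := by
      by_contra! h0
      exact hl (LinearMap.ext h0)
    exact ⟨(-(l u)⁻¹) • u, by simp [hu]⟩
  have hker : ∀ v, l v = 0 → m v ≤ 0 := by
    intro v hv
    by_contra! hpos
    -- A small multiple of `u` moves `v` into the open half-space; the coefficient is chosen so that
    -- `m` changes by at most `m v / 2` and stays positive.
    have h1 := h (v + (m v / (2 * (|m u| + 1))) • u) (by
      simp only [map_add, map_smul, hv, hu, smul_eq_mul, zero_add]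
      have : 0 < m v / (2 * (|m u| + 1)) := by positivity
      linarith)
    simp only [map_add, map_smul, smul_eq_mul] at h1
    have h2 : m v / (2 * (|m u| + 1)) * |m u| ≤ m v / 2 := by
      rw [div_mul_eq_mul_div, div_le_div_iff₀ (by positivity) (by norm_num)]
      nlinarith [abs_nonneg (m u)]
    have h3 : m v / (2 * (|m u| + 1)) * (-|m u|) ≤ m v / (2 * (|m u| + 1)) * m u :=
      mul_le_mul_of_nonneg_left (neg_abs_le _) (by positivity)
    linarith
  have hker' : ∀ v, l v = 0 → m v = 0 := fun v hv =>
    le_antisymm (hker v hv) (by simpa using hker (-v) (by simp [hv]))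
  refine ⟨-m u, by linarith [h u (by rw [hu]; norm_num)], fun v => ?_⟩
  have := hker' (v + l v • u) (by simp [hu])
  simp only [map_add, map_smul, smul_eq_mul] at this
  linarith

theorem IsLocalDefiningFunction.differentiableAt {n : ℕ} {Ω : Set (EuclideanSpace ℂ (Fin n))}
    {p : EuclideanSpace ℂ (Fin n)} {r : EuclideanSpace ℂ (Fin n) → ℝ}
    (h : IsLocalDefiningFunction Ω p r) : DifferentiableAt ℝ r p := by
  obtain ⟨W, hW, hpW, hr, -, -⟩ := h
  exact (hr.contDiffAt (hW.mem_nhds hpW)).differentiableAt (by norm_num)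

theorem IsLocalDefiningFunction.apply_eq_zero {n : ℕ} {Ω : Set (EuclideanSpace ℂ (Fin n))}
    (hΩ : IsOpen Ω) {p : EuclideanSpace ℂ (Fin n)} (hp : p ∈ frontier Ω)
    {r : EuclideanSpace ℂ (Fin n) → ℝ}
    (h : IsLocalDefiningFunction Ω p r) : r p = 0 := by
  have hd := h.differentiableAt.continuousAt
  obtain ⟨W, hW, hpW, hr, -, hΩW⟩ := h
  rw [hΩ.frontier_eq] at hp
  apply le_antisymm
  · by_contra! hpos
    have hev : ∀ᶠ q in 𝓝 p, q ∈ W ∧ 0 < r q :=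
      Filter.Eventually.and (hW.mem_nhds hpW) (hd.eventually (lt_mem_nhds hpos))
    obtain ⟨q, hq1, hq2⟩ := mem_closure_iff_nhds.1 hp.1 _ hev
    have : q ∈ Ω ∩ W := ⟨hq2, hq1.1⟩
    rw [hΩW] at this
    exact absurd this.2 (not_lt.2 hq1.2.le)
  · by_contra! hneg
    have : p ∈ Ω ∩ W := by rw [hΩW]; exact ⟨hpW, hneg⟩
    exact hp.2 this.1

/-- Along a ray from a boundary point that enters `Ω`, a defining function does not increase. -/
theorem IsLocalDefiningFunction.fderiv_nonpos {n : ℕ} {Ω : Set (EuclideanSpace ℂ (Fin n))}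
    (hΩ : IsOpen Ω) {p : EuclideanSpace ℂ (Fin n)} (hp : p ∈ frontier Ω)
    {r : EuclideanSpace ℂ (Fin n) → ℝ}
    (h : IsLocalDefiningFunction Ω p r) (v : EuclideanSpace ℂ (Fin n))
    (hv : ∀ᶠ t : ℝ in 𝓝[>] 0, p + t • v ∈ Ω) : fderiv ℝ r p v ≤ 0 := by
  have h0 := h.apply_eq_zero hΩ hp
  have hl : HasDerivWithinAt (fun t : ℝ => r (p + t • v)) (fderiv ℝ r p v) (Ioi 0) 0 :=
    (h.differentiableAt.hasFDerivAt.hasLineDerivAt v).hasDerivWithinAt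
  rw [hasDerivWithinAt_iff_tendsto_slope' (by simp)] at hl
  obtain ⟨W, hW, hpW, hr, -, hΩW⟩ := h
  have hWev : ∀ᶠ t : ℝ in 𝓝[>] 0, p + t • v ∈ W := by
    have : ContinuousAt (fun t : ℝ => p + t • v) 0 := by fun_prop
    exact (this.mono_left nhdsWithin_le_nhds) (by simpa using hW.mem_nhds hpW)
  refine le_of_tendsto hl ?_
  filter_upwards [hv, hWev, self_mem_nhdsWithin] with t ht1 ht2 ht3
  have : p + t • v ∈ Ω ∩ W := ⟨ht1, ht2⟩
  rw [hΩW] at this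
  simp only [slope, vsub_eq_sub, sub_zero, zero_smul, add_zero, h0, smul_eq_mul]
  exact mul_nonpos_of_nonneg_of_nonpos (inv_nonneg.2 (le_of_lt ht3)) this.2.le

theorem IsLocalDefiningFunction.eventually_mem {n : ℕ} {Ω : Set (EuclideanSpace ℂ (Fin n))}
    (hΩ : IsOpen Ω) {p : EuclideanSpace ℂ (Fin n)} (hp : p ∈ frontier Ω)
    {r : EuclideanSpace ℂ (Fin n) → ℝ}
    (h : IsLocalDefiningFunction Ω p r) (v : EuclideanSpace ℂ (Fin n))
    (hv : fderiv ℝ r p v < 0) : ∀ᶠ t : ℝ in 𝓝[>] 0, p + t • v ∈ Ω := by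
  have h0 := h.apply_eq_zero hΩ hp
  have hl : HasDerivWithinAt (fun t : ℝ => r (p + t • v)) (fderiv ℝ r p v) (Ioi 0) 0 :=
    (h.differentiableAt.hasFDerivAt.hasLineDerivAt v).hasDerivWithinAt
  rw [hasDerivWithinAt_iff_tendsto_slope' (by simp)] at hl
  obtain ⟨W, hW, hpW, hr, -, hΩW⟩ := h
  have hWev : ∀ᶠ t : ℝ in 𝓝[>] 0, p + t • v ∈ W := by
    have : ContinuousAt (fun t : ℝ => p + t • v) 0 := by fun_prop
    exact (this.mono_left nhdsWithin_le_nhds) (by simpa using hW.mem_nhds hpW)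
  filter_upwards [hl.eventually (gt_mem_nhds hv), hWev, self_mem_nhdsWithin] with t ht1 ht2 ht3
  have ht3' : 0 < t := ht3
  have : p + t • v ∈ Ω ∩ W := by
    rw [hΩW]
    refine ⟨ht2, ?_⟩
    simp only [slope, vsub_eq_sub, sub_zero, zero_smul, add_zero, h0, smul_eq_mul] at ht1
    by_contra! hge
    exact absurd ht1 (not_lt.2 (by positivity))
  exact this.1

/-- Directions in which `r` decreases to first order enter `Ω`, so `r'` cannot increase along them.
This makes normals and complex tangents independent of the defining function. -/
theorem IsLocalDefiningFunction.fderiv_eq_mul {n : ℕ} {Ω : Set (EuclideanSpace ℂ (Fin n))}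
    (hΩ : IsOpen Ω) {p : EuclideanSpace ℂ (Fin n)} (hp : p ∈ frontier Ω)
    {r r' : EuclideanSpace ℂ (Fin n) → ℝ}
    (h : IsLocalDefiningFunction Ω p r) (h' : IsLocalDefiningFunction Ω p r') :
    ∃ c : ℝ, 0 ≤ c ∧ ∀ v, fderiv ℝ r' p v = c * fderiv ℝ r p v := by
  have hne : (fderiv ℝ r p : EuclideanSpace ℂ (Fin n) →ₗ[ℝ] ℝ) ≠ 0 := by
    obtain ⟨W, -, -, -, hne, -⟩ := h
    intro h0
    exact hne (ContinuousLinearMap.coe_injective h0)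
  exact nonneg_multiple_of_halfspace (fderiv ℝ r p : _ →ₗ[ℝ] ℝ) (fderiv ℝ r' p : _ →ₗ[ℝ] ℝ) hne
    fun v hv => h'.fderiv_nonpos hΩ hp v (h.eventually_mem hΩ hp v hv)

/-- The real part of the pairing with a fixed vector, as a real linear functional. -/
noncomputable def reInner {n : ℕ} (N : EuclideanSpace ℂ (Fin n)) :
    EuclideanSpace ℂ (Fin n) →ₗ[ℝ] ℝ where
  toFun v := (inner ℂ N v).re
  map_add' := by simp
  map_smul' := by
    intro c v
    rw [RCLike.real_smul_eq_coe_smul (K := ℂ), inner_smul_right]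
    simp

theorem eq_smul_of_re_inner {n : ℕ} {N z : EuclideanSpace ℂ (Fin n)} {c : ℝ}
    (h : ∀ v, (inner ℂ N v).re = c * (inner ℂ z v).re) : N = (c : ℂ) • z := by
  rw [← sub_eq_zero, ← inner_self_eq_zero (𝕜 := ℂ)]
  set u := N - (c : ℂ) • z
  have h1 : (inner ℂ u u).re = 0 := by
    change (inner ℂ (N - (c : ℂ) • z) u).re = 0
    rw [inner_sub_left, inner_smul_left, Complex.sub_re, h u]
    simp
  have := inner_self_ofReal_re (𝕜 := ℂ) u
  rw [← this]
  simpa using h1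

theorem IsUnitOutwardNormal.eq {n : ℕ} {Ω : Set (EuclideanSpace ℂ (Fin n))}
    (hΩ : IsOpen Ω) {p N N' : EuclideanSpace ℂ (Fin n)} (hp : p ∈ frontier Ω)
    (h : IsUnitOutwardNormal Ω p N) (h' : IsUnitOutwardNormal Ω p N') : N = N' := by
  obtain ⟨h1, r, hr, c, hc, hN⟩ := h
  obtain ⟨h1', r', hr', c', hc', hN'⟩ := h'
  obtain ⟨b, hb, hrr⟩ := hr'.fderiv_eq_mul hΩ hp hr
  have : N = ((b * c' / c : ℝ) : ℂ) • N' := by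
    apply eq_smul_of_re_inner
    intro v
    have := hrr v
    rw [hN, hN'] at this
    field_simp
    linarith
  have hn : ‖N‖ = b * c' / c := by
    conv_lhs => rw [this]
    rw [norm_smul, h1', Complex.norm_real, Real.norm_of_nonneg (by positivity), mul_one]
  rw [h1] at hn
  rw [this, ← hn]; simp

/-- Tangency of `v` kills the real part of the pairing with `N`, and tangency of `i v` kills the
imaginary part. -/
theorem IsUnitOutwardNormal.isComplexTangent_iff {n : ℕ} {Ω : Set (EuclideanSpace ℂ (Fin n))}
    (hΩ : IsOpen Ω) {p N : EuclideanSpace ℂ (Fin n)} (hp : p ∈ frontier Ω)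
    (h : IsUnitOutwardNormal Ω p N) (v : EuclideanSpace ℂ (Fin n)) :
    IsComplexTangent Ω p v ↔ inner ℂ N v = 0 := by
  obtain ⟨h1, r, hr, c, hc, hN⟩ := h
  constructor
  · rintro ⟨r', hr', hv, hiv⟩
    obtain ⟨b, hb, hrr⟩ := hr'.fderiv_eq_mul hΩ hp hr
    have e1 := hrr v
    have e2 := hrr (Complex.I • v)
    rw [hN, hv, mul_zero] at e1
    rw [hN, hiv, mul_zero, inner_smul_right] at e2
    have e1 := (mul_eq_zero.1 e1).resolve_left hc.ne'
    have e2 := (mul_eq_zero.1 e2).resolve_left hc.ne'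
    apply Complex.ext
    · simpa using e1
    · simpa using e2
  · intro hv
    refine ⟨r, hr, ?_, ?_⟩
    · rw [hN, hv]; simp
    · rw [hN, inner_smul_right, hv]; simp

/-- The ball touches the boundary from inside at `p`. Every direction entering the ball enters `Ω`,
so `dr(p)` is a nonnegative multiple of the pairing with `p - z`, and `N` is parallel to `p - z`. -/
theorem sub_eq_neg_infDist_smul_normal {n : ℕ} {Ω : Set (EuclideanSpace ℂ (Fin n))}
    (hΩ : IsOpen Ω) {p N z : EuclideanSpace ℂ (Fin n)} (hp : p ∈ frontier Ω)
    (h : IsUnitOutwardNormal Ω p N) (hz : dist z p ≠ 0) (hball : Metric.ball z (dist z p) ⊆ Ω) :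
    z = p - ((dist z p : ℝ) : ℂ) • N := by
  obtain ⟨h1, r, hr, c, hc, hN⟩ := h
  have hne : reInner (p - z) ≠ 0 := by
    intro h0
    have := LinearMap.congr_fun h0 (p - z)
    simp only [reInner, LinearMap.coe_mk, AddHom.coe_mk, LinearMap.zero_apply] at this
    have h2 : (inner ℂ (p - z) (p - z)).re = ‖p - z‖ ^ 2 := by
      rw [inner_self_eq_norm_sq_to_K]; norm_cast
    rw [h2] at this
    apply hz
    rw [dist_comm, dist_eq_norm]
    exact pow_eq_zero_iff (two_ne_zero) |>.1 this
  obtain ⟨b, hb, hm⟩ := nonneg_multiple_of_halfspace (reInner (p - z))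
    (fderiv ℝ r p : _ →ₗ[ℝ] ℝ) hne fun v hv => hr.fderiv_nonpos hΩ hp v (by
      have hv' : (inner ℂ (p - z) v).re < 0 := hv
      -- The expression is the increment of `‖p + t • v - z‖ ^ 2` from `t = 0`, divided by `t`.
      have hlim : ∀ᶠ t : ℝ in 𝓝[>] 0, 2 * (inner ℂ (p - z) v).re + t * ‖v‖ ^ 2 < 0 := by
        have : ContinuousAt (fun t : ℝ => 2 * (inner ℂ (p - z) v).re + t * ‖v‖ ^ 2) 0 := by
          fun_prop
        exact (this.mono_left nhdsWithin_le_nhds).eventually (gt_mem_nhds (by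
          simp only [zero_mul, add_zero]; linarith))
      filter_upwards [hlim, self_mem_nhdsWithin] with t ht ht0
      have ht0 : 0 < t := ht0
      apply hball
      rw [Metric.mem_ball, dist_eq_norm, dist_comm, dist_eq_norm]
      apply lt_of_pow_lt_pow_left₀ 2 (norm_nonneg _)
      rw [show p + t • v - z = (p - z) + (t : ℂ) • v by
        rw [RCLike.real_smul_eq_coe_smul (K := ℂ)]; simp; abel]
      rw [@norm_add_sq ℂ, inner_smul_right, norm_smul, Complex.norm_real,
        Real.norm_of_nonneg ht0.le]
      have : RCLike.re ((t : ℂ) * inner ℂ (p - z) v) = t * (inner ℂ (p - z) v).re := by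
        simp
      rw [this]
      nlinarith)
  have key : N = ((b / c : ℝ) : ℂ) • (p - z) := by
    apply eq_smul_of_re_inner
    intro v
    have := hm v
    simp only [ContinuousLinearMap.coe_coe, hN] at this
    simp only [reInner, LinearMap.coe_mk, AddHom.coe_mk] at this
    field_simp
    linarith
  have hn : 1 = b / c * dist z p := by
    rw [← h1, key, norm_smul, Complex.norm_real, Real.norm_of_nonneg (by positivity), dist_comm,
      dist_eq_norm]
  rw [key, smul_smul, ← Complex.ofReal_mul, mul_comm, ← hn]
  simp

/-! ### Continuity of the unit normal -/

theorem IsLocalDefiningFunction.exists_continuous_normal {n : ℕ}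
    {Ω : Set (EuclideanSpace ℂ (Fin n))} {p : EuclideanSpace ℂ (Fin n)}
    {r : EuclideanSpace ℂ (Fin n) → ℝ} (h : IsLocalDefiningFunction Ω p r) :
    ∃ ν : EuclideanSpace ℂ (Fin n) → EuclideanSpace ℂ (Fin n), ContinuousAt ν p ∧
      ∀ᶠ q in 𝓝 p, IsUnitOutwardNormal Ω q (ν q) := by
  obtain ⟨W, hW, hpW, hr, hne, hΩW⟩ := h
  set g : EuclideanSpace ℂ (Fin n) → EuclideanSpace ℂ (Fin n) := fun q =>
    (InnerProductSpace.toDual ℝ (EuclideanSpace ℂ (Fin n))).symm (fderiv ℝ r q) with hg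
  have hcf : ContinuousAt (fderiv ℝ r) p :=
    (hr.continuousOn_fderiv_of_isOpen hW le_rfl).continuousAt (hW.mem_nhds hpW)
  have hcg : ContinuousAt g p :=
    (InnerProductSpace.toDual ℝ (EuclideanSpace ℂ (Fin n))).symm.continuous.continuousAt.comp hcf
  have hgp : ‖g p‖ ≠ 0 := by
    simpa [hg] using hne
  have hgv : ∀ q v, fderiv ℝ r q v = (inner ℂ (g q) v).re := by
    intro q v
    have : inner ℝ (g q) v = fderiv ℝ r q v := by
      simp [hg]
    rw [← this, PiLp.inner_apply, PiLp.inner_apply, Complex.re_sum]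
    rfl
  refine ⟨fun q => ((‖g q‖⁻¹ : ℝ) : ℂ) • g q, ?_, ?_⟩
  · exact (Complex.continuous_ofReal.continuousAt.comp (hcg.norm.inv₀ hgp)).smul hcg
  · filter_upwards [hW.mem_nhds hpW, hcg.norm.eventually_ne hgp] with q hqW hq
    have hq0 : 0 < ‖g q‖ := lt_of_le_of_ne (norm_nonneg _) (Ne.symm hq)
    refine ⟨?_, r, ⟨W, hW, hqW, hr, ?_, hΩW⟩, ‖g q‖, hq0, fun v => ?_⟩
    · rw [norm_smul, Complex.norm_real, norm_inv, norm_norm, inv_mul_cancel₀ hq]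
    · intro h0
      apply hq
      simp [hg, h0]
    · rw [hgv, inner_smul_left]
      simp [hq]

/-- Normalized gradients of local defining functions are continuous, and uniqueness of the normal
makes them agree on overlaps. -/
theorem HasC1Boundary.exists_continuousOn_normal {n : ℕ} {Ω : Set (EuclideanSpace ℂ (Fin n))}
    (hΩ : IsOpen Ω) (hb : HasC1Boundary Ω) :
    ∃ ν : EuclideanSpace ℂ (Fin n) → EuclideanSpace ℂ (Fin n), ContinuousOn ν (frontier Ω) ∧
      ∀ p ∈ frontier Ω, IsUnitOutwardNormal Ω p (ν p) := by
  have hex : ∀ p, ∃ N, p ∈ frontier Ω → IsUnitOutwardNormal Ω p N := by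
    intro p
    by_cases hp : p ∈ frontier Ω
    · obtain ⟨r, hr⟩ := hb p hp
      obtain ⟨ν, -, hν⟩ := hr.exists_continuous_normal
      exact ⟨ν p, fun _ => hν.self_of_nhds⟩
    · exact ⟨0, fun h => absurd h hp⟩
  choose ν hν using hex
  refine ⟨ν, fun p hp => ?_, hν⟩
  obtain ⟨r, hr⟩ := hb p hp
  obtain ⟨μ, hμc, hμ⟩ := hr.exists_continuous_normal
  refine hμc.continuousWithinAt.congr_of_eventuallyEq ?_ ((hν p hp).eq hΩ hp hμ.self_of_nhds)
  filter_upwards [self_mem_nhdsWithin, nhdsWithin_le_nhds hμ] with q hq hq'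
  exact (hν q hq).eq hΩ hq hq'

/-- A ball around a point of `Ω` that does not meet `∂Ω` lies in `Ω`. -/
theorem ball_infDist_frontier_subset {n : ℕ} {Ω : Set (EuclideanSpace ℂ (Fin n))}
    (hΩ : IsOpen Ω) {z : EuclideanSpace ℂ (Fin n)} (hz : z ∈ Ω) :
    Metric.ball z (Metric.infDist z (frontier Ω)) ⊆ Ω := by
  rcases le_or_gt (Metric.infDist z (frontier Ω)) 0 with h0 | h0
  · simp [Metric.ball_eq_empty.2 h0]
  refine (convex_ball z _).isPreconnected.subset_left_of_subset_union hΩ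
    (isClosed_closure (s := Ω)).isOpen_compl
    (disjoint_compl_right_iff_subset.2 subset_closure) (fun x hx => ?_)
    ⟨z, Metric.mem_ball_self h0, hz⟩
  by_contra hn
  rw [mem_union, not_or, mem_compl_iff, not_not] at hn
  have := Metric.infDist_le_dist_of_mem (x := z) (s := frontier Ω)
    (hΩ.frontier_eq ▸ ⟨hn.2, hn.1⟩ : x ∈ frontier Ω)
  rw [Metric.mem_ball, dist_comm] at hx
  linarith

/-! ### Cauchy estimates on tangential discs -/

/-- Cauchy estimate for a holomorphic function along a complex disc contained in `Ω`. -/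
theorem norm_deriv_zero_le {g : ℂ → ℂ} {R B : ℝ} (hR : 0 < R) (hg : ∀ w : ℂ, ‖w‖ ≤ R → DifferentiableAt ℂ g w)
    (hB : ∀ w : ℂ, ‖w‖ ≤ R → ‖g w‖ ≤ B) : ‖deriv g 0‖ ≤ B / R := by
  refine Complex.norm_deriv_le_of_forall_mem_sphere_norm_le hR ?_ fun w hw => hB w ?_
  · apply DifferentiableOn.diffContOnCl
    intro w hw
    apply (hg w ?_).differentiableWithinAt
    rw [closure_ball _ hR.ne'] at hw
    simpa using hw
  · simpa using (mem_sphere_iff_norm.1 hw).le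

theorem DifferentiableOn.differentiableAt_line {n : ℕ} {Ω : Set (EuclideanSpace ℂ (Fin n))}
    (hΩ : IsOpen Ω) {f : EuclideanSpace ℂ (Fin n) → ℂ} (hf : DifferentiableOn ℂ f Ω)
    (z L : EuclideanSpace ℂ (Fin n)) (w : ℂ) (hw : z + w • L ∈ Ω) :
    DifferentiableAt ℂ (fun w : ℂ => f (z + w • L)) w := by
  have h1 : DifferentiableAt ℂ f (z + w • L) := (hf _ hw).differentiableAt (hΩ.mem_nhds hw)
  exact h1.comp w (by fun_prop)

theorem HolderOnWith.norm_sub_le' {E : Type*} [NormedAddCommGroup E] {Ω : Set E} {f : E → ℂ}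
    {K α : ℝ≥0} (h : HolderOnWith K α f Ω) {x y : E} (hx : x ∈ Ω) (hy : y ∈ Ω) {d : ℝ}
    (hd : ‖x - y‖ ≤ d) : ‖f x - f y‖ ≤ K * d ^ (α : ℝ) := by
  rw [← dist_eq_norm]
  exact h.dist_le_of_le hx hy (by rwa [dist_eq_norm])

/-- First-order Hölder/Cauchy estimate on a disc. -/
theorem norm_deriv_line_le_of_holder {n : ℕ} {Ω : Set (EuclideanSpace ℂ (Fin n))}
    (hΩ : IsOpen Ω) {f : EuclideanSpace ℂ (Fin n) → ℂ} (hf : DifferentiableOn ℂ f Ω)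
    {K α : ℝ≥0} (hK : HolderOnWith K α f Ω) {z L : EuclideanSpace ℂ (Fin n)} (hL : ‖L‖ = 1)
    {R : ℝ} (hR : 0 < R) (hdisc : ∀ w : ℂ, ‖w‖ ≤ R → z + w • L ∈ Ω) :
    ‖deriv (fun w : ℂ => f (z + w • L)) 0‖ ≤ K * R ^ (α : ℝ) / R := by
  have hz : z ∈ Ω := by simpa using hdisc 0 (by simpa using hR.le)
  have := norm_deriv_zero_le (g := fun w : ℂ => f (z + w • L) - f z) hR
    (B := K * R ^ (α : ℝ))
    (fun w hw => (hf.differentiableAt_line hΩ z L w (hdisc w hw)).sub_const _)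
    (fun w hw => hK.norm_sub_le' (hdisc w hw) hz (by simpa [norm_smul, hL] using hw))
  simpa using this

/-- If the tangential discs at depth `δ` have radius at least `c δ ^ (1/k)`, the tangential
derivative of an `α`-Hölder holomorphic function is `O(δ ^ (α - 1/k))`. -/
theorem norm_deriv_line_le_of_discs {n : ℕ} {Ω : Set (EuclideanSpace ℂ (Fin n))}
    (hΩ : IsOpen Ω) {f : EuclideanSpace ℂ (Fin n) → ℂ} (hf : DifferentiableOn ℂ f Ω)
    {K α : ℝ≥0} (hK : HolderOnWith K α f Ω) {κ D c : ℝ} (hD : 0 < D) (hc : 0 < c)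
    (hα : (α : ℝ) < κ) :
    ∃ A : ℝ, 0 ≤ A ∧ ∀ z N L : EuclideanSpace ℂ (Fin n), ‖L‖ = 1 → ‖N‖ = 1 →
      (∀ δ : ℝ, 0 < δ → δ ≤ D → ∀ w : ℂ, ‖w‖ ≤ c * δ ^ κ → z - (δ : ℂ) • N + w • L ∈ Ω) →
      ∀ δ : ℝ, 0 < δ → δ ≤ D →
        ‖deriv (fun w : ℂ => f (z - (δ : ℂ) • N + w • L)) 0‖ ≤ A * δ ^ ((α : ℝ) - κ) := by
  set β : ℝ := κ - α with hβ
  have hβ0 : 0 < β := by linarith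
  have hκ0 : 0 < κ := lt_of_le_of_lt α.2 hα
  set θ : ℝ := (2 : ℝ) ^ (-β) with hθ
  have hθ1 : θ < 1 := Real.rpow_lt_one_of_one_lt_of_neg (by norm_num) (by linarith)
  have hθ0 : 0 < θ := by positivity
  -- `A₁` is the sum of the geometric series of doubling errors, with ratio `θ`; `A₂` covers the top
  -- range `D / 2 < δ ≤ D`, where a single Cauchy estimate suffices.
  set A₁ : ℝ := K / c / (1 - θ) with hA₁
  set R₀ : ℝ := c * (D / 2) ^ κ with hR₀
  set A₂ : ℝ := (K * R₀ ^ (α : ℝ) / R₀) * D ^ β with hA₂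
  have hR₀0 : 0 < R₀ := by positivity
  have h1θ : 0 < 1 - θ := by linarith
  have hA₁0 : 0 ≤ A₁ := by positivity
  have hA₂0 : 0 ≤ A₂ := by positivity
  refine ⟨A₁ + A₂, by positivity, fun z N L hL hN hdisc => ?_⟩
  have hαβ : (α : ℝ) - κ = -β := by ring
  rw [hαβ]
  have hbase : ∀ δ : ℝ, D / 2 < δ → δ ≤ D →
      ‖deriv (fun w : ℂ => f (z - (δ : ℂ) • N + w • L)) 0‖ ≤ (A₁ + A₂) * δ ^ (-β) := by
    intro δ h1 h2
    have hδ0 : 0 < δ := by linarith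
    have := norm_deriv_line_le_of_holder hΩ hf hK (z := z - (δ : ℂ) • N) hL hR₀0
      (fun w hw => hdisc δ hδ0 h2 w (hw.trans (by
        apply mul_le_mul_of_nonneg_left _ hc.le
        exact Real.rpow_le_rpow (by positivity) h1.le hκ0.le)))
    refine this.trans ?_
    have h3 : 1 ≤ D ^ β * δ ^ (-β) := by
      rw [Real.rpow_neg hδ0.le, ← div_eq_mul_inv, one_le_div (by positivity)]
      exact Real.rpow_le_rpow hδ0.le h2 hβ0.le
    calc K * R₀ ^ (α : ℝ) / R₀ ≤ (K * R₀ ^ (α : ℝ) / R₀) * (D ^ β * δ ^ (-β)) :=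
          le_mul_of_one_le_right (by positivity) h3
      _ = A₂ * δ ^ (-β) := by rw [hA₂]; ring
      _ ≤ _ := mul_le_mul_of_nonneg_right (by linarith) (by positivity)
  have hstep : ∀ δ : ℝ, 0 < δ → δ ≤ D / 2 →
      ‖deriv (fun w : ℂ => f (z - ((2 * δ : ℝ) : ℂ) • N + w • L)) 0‖
        ≤ (A₁ + A₂) * (2 * δ) ^ (-β) →
      ‖deriv (fun w : ℂ => f (z - (δ : ℂ) • N + w • L)) 0‖ ≤ (A₁ + A₂) * δ ^ (-β) := by
    intro δ h0 h1 ih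
    have hR : 0 < c * δ ^ κ := by positivity
    have hin1 : ∀ w : ℂ, ‖w‖ ≤ c * δ ^ κ → z - (δ : ℂ) • N + w • L ∈ Ω :=
      hdisc δ h0 (by linarith)
    have hin2 : ∀ w : ℂ, ‖w‖ ≤ c * δ ^ κ → z - ((2 * δ : ℝ) : ℂ) • N + w • L ∈ Ω := fun w hw =>
      hdisc (2 * δ) (by linarith) (by linarith) w (hw.trans (by
        apply mul_le_mul_of_nonneg_left _ hc.le
        exact Real.rpow_le_rpow h0.le (by linarith) hκ0.le))
    have hd1 := fun w hw => hf.differentiableAt_line hΩ (z - (δ : ℂ) • N) L w (hin1 w hw)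
    have hd2 := fun w hw => hf.differentiableAt_line hΩ (z - ((2 * δ : ℝ) : ℂ) • N) L w (hin2 w hw)
    have hcau := norm_deriv_zero_le
      (g := fun w : ℂ => f (z - (δ : ℂ) • N + w • L) - f (z - ((2 * δ : ℝ) : ℂ) • N + w • L)) hR
      (B := K * δ ^ (α : ℝ)) (fun w hw => (hd1 w hw).sub (hd2 w hw))
      (fun w hw => hK.norm_sub_le' (hin1 w hw) (hin2 w hw) (le_of_eq (by
        rw [show z - (δ : ℂ) • N + w • L - (z - ((2 * δ : ℝ) : ℂ) • N + w • L) = (δ : ℂ) • N by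
          push_cast; module]
        rw [norm_smul, hN, Complex.norm_real, Real.norm_of_nonneg h0.le, mul_one])))
    have h00 : ‖(0 : ℂ)‖ ≤ c * δ ^ κ := by simpa using hR.le
    rw [deriv_fun_sub (hd1 0 h00) (hd2 0 h00)] at hcau
    have e1 : K * δ ^ (α : ℝ) / (c * δ ^ κ) = (1 - θ) * A₁ * δ ^ (-β) := by
      rw [← hαβ, Real.rpow_sub h0, hA₁]
      field_simp
    have e2 : (2 * δ) ^ (-β) = θ * δ ^ (-β) := Real.mul_rpow (by norm_num) h0.le
    rw [e1] at hcau
    rw [e2] at ih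
    have htri := norm_le_norm_add_norm_sub' (deriv (fun w : ℂ => f (z - (δ : ℂ) • N + w • L)) 0)
      (deriv (fun w : ℂ => f (z - ((2 * δ : ℝ) : ℂ) • N + w • L)) 0)
    -- The bound closes because `(1 - θ) * A₁ + θ * (A₁ + A₂) = A₁ + θ * A₂ ≤ A₁ + A₂`.
    have hX : 0 ≤ (1 - θ) * A₂ * δ ^ (-β) := by positivity
    nlinarith
  -- Induction on a bound for the number of doublings needed to reach the top range.
  have hind : ∀ m : ℕ, ∀ δ : ℝ, 0 < δ → δ ≤ D → D < 2 ^ (m + 1) * δ →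
      ‖deriv (fun w : ℂ => f (z - (δ : ℂ) • N + w • L)) 0‖ ≤ (A₁ + A₂) * δ ^ (-β) := by
    intro m
    induction m with
    | zero => exact fun δ h0 h1 h2 => hbase δ (by norm_num at h2; linarith) h1
    | succ m ih =>
      intro δ h0 h1 h2
      rcases lt_or_ge (D / 2) δ with h | h
      · exact hbase δ h h1
      · exact hstep δ h0 h (ih (2 * δ) (by linarith) (by linarith)
          (by rw [pow_succ] at h2; linarith))
  intro δ h0 h1
  obtain ⟨m, hm⟩ := pow_unbounded_of_one_lt (D / δ) (one_lt_two : (1 : ℝ) < 2)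
  refine hind m δ h0 h1 ?_
  rw [div_lt_iff₀ h0] at hm
  rw [pow_succ]
  have : 0 < (2 : ℝ) ^ m * δ := by positivity
  linarith

/-! ### Curves, perturbed normals and nearest points -/

/-- Mean value inequality for `f` along a translate of a curve. -/
theorem norm_comp_curve_sub_le {n : ℕ} {Ω : Set (EuclideanSpace ℂ (Fin n))}
    (hΩ : IsOpen Ω) {f : EuclideanSpace ℂ (Fin n) → ℂ} (hf : DifferentiableOn ℂ f Ω)
    {γ : ℝ → EuclideanSpace ℂ (Fin n)} (hγ : ContDiffOn ℝ 2 γ (Icc 0 1))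
    (v : EuclideanSpace ℂ (Fin n)) {s t B : ℝ} (hs : s ∈ Icc (0 : ℝ) 1) (ht : t ∈ Icc (0 : ℝ) 1)
    (hin : ∀ x ∈ uIcc s t, γ x - v ∈ Ω)
    (hB : ∀ x ∈ uIcc s t,
      ‖deriv (fun w : ℂ => f (γ x - v + w • derivWithin γ (Icc 0 1) x)) 0‖ ≤ B) :
    ‖f (γ s - v) - f (γ t - v)‖ ≤ B * |s - t| := by
  have hsub : uIcc s t ⊆ Icc 0 1 := uIcc_subset_Icc hs ht
  have hder : ∀ x ∈ uIcc s t, HasDerivWithinAt (fun x => f (γ x - v))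
      (deriv (fun w : ℂ => f (γ x - v + w • derivWithin γ (Icc 0 1) x)) 0) (uIcc s t) x := by
    intro x hx
    have h1 : HasDerivWithinAt γ (derivWithin γ (Icc 0 1) x) (uIcc s t) x :=
      (((hγ.differentiableOn (by norm_num)) x (hsub hx)).hasDerivWithinAt).mono hsub
    have h2 : HasFDerivAt f (fderiv ℂ f (γ x - v)) (γ x - v) :=
      ((hf _ (hin x hx)).differentiableAt (hΩ.mem_nhds (hin x hx))).hasFDerivAt
    have h3 : deriv (fun w : ℂ => f (γ x - v + w • derivWithin γ (Icc 0 1) x)) 0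
        = fderiv ℂ f (γ x - v) (derivWithin γ (Icc 0 1) x) :=
      (h2.hasLineDerivAt _).deriv
    rw [h3]
    exact (h2.restrictScalars ℝ).comp_hasDerivWithinAt x (h1.sub_const v)
  have := (convex_uIcc s t).norm_image_sub_le_of_norm_hasDerivWithin_le hder hB
    right_mem_uIcc left_mem_uIcc
  simpa using this

theorem norm_curve_sub_le {n : ℕ} {γ : ℝ → EuclideanSpace ℂ (Fin n)}
    (hγ : ContDiffOn ℝ 2 γ (Icc 0 1)) (h1 : ∀ t ∈ Icc (0 : ℝ) 1, ‖derivWithin γ (Icc 0 1) t‖ = 1)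
    {s t : ℝ} (hs : s ∈ Icc (0 : ℝ) 1) (ht : t ∈ Icc (0 : ℝ) 1) : ‖γ s - γ t‖ ≤ |s - t| := by
  have := (convex_Icc (0 : ℝ) 1).norm_image_sub_le_of_norm_hasDerivWithin_le
    (fun x hx => ((hγ.differentiableOn (by norm_num)) x hx).hasDerivWithinAt)
    (fun x hx => (h1 x hx).le) ht hs
  simpa using this

/-- The disc property at `p` persists when the inward shift is made along a vector close to the
normal at `p`. -/
theorem UniformDiscPropertyWith.mem_of_near_normal {n : ℕ} {Ω S : Set (EuclideanSpace ℂ (Fin n))}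
    (hΩ : IsOpen Ω) {k : ℕ} {δ₀ c₁ c₂ : ℝ} (h : UniformDiscPropertyWith Ω S k δ₀ c₁ c₂)
    {p N N₀ L : EuclideanSpace ℂ (Fin n)} (hpS : p ∈ S) (hp : p ∈ frontier Ω)
    (hN : IsUnitOutwardNormal Ω p N) (hL : IsComplexTangent Ω p L) (hL1 : ‖L‖ = 1)
    {ε d δ : ℝ} (hNε : ‖N₀ - N‖ ≤ ε) (hε₁ : ε ≤ c₁)
    (hd : 0 ≤ d) (hδ : 0 < δ) (hdδ : d + δ ≤ δ₀)
    (hε₂ : 2 * ε * δ ≤ c₂ / 2 * δ ^ (1 / (k : ℝ)))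
    {w : ℂ} (hw : ‖w‖ ≤ c₂ / 2 * δ ^ (1 / (k : ℝ))) :
    p - (d : ℂ) • N - (δ : ℂ) • N₀ + w • L ∈ Ω := by
  obtain ⟨hδ₀, hc₁, hc₂, hdisc⟩ := h
  have hN1 : ‖N‖ = 1 := hN.1
  have hNN : inner ℂ N N = 1 := by
    rw [inner_self_eq_norm_sq_to_K, hN1]; simp
  -- Split `N₀ - N` into `b • N`, absorbed by the parameter `w₁`, and a complex tangential part `σ`,
  -- which joins `w • L` in the `w₂` direction.
  set b : ℂ := inner ℂ N (N₀ - N) with hb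
  have hbε : ‖b‖ ≤ ε := by
    have := norm_inner_le_norm (𝕜 := ℂ) N (N₀ - N)
    rw [hN1, one_mul] at this
    exact this.trans hNε
  set σ : EuclideanSpace ℂ (Fin n) := (N₀ - N) - b • N with hσ
  have hσε : ‖σ‖ ≤ 2 * ε := by
    have := norm_sub_le (N₀ - N) (b • N)
    rw [norm_smul, hN1, mul_one] at this
    linarith
  have hσN : inner ℂ N σ = 0 := by
    rw [hσ, inner_sub_right, inner_smul_right, hNN, ← hb]; simp
  set v : EuclideanSpace ℂ (Fin n) := w • L - (δ : ℂ) • σ with hv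
  have hvN : inner ℂ N v = 0 := by
    rw [hv, inner_sub_right, inner_smul_right, inner_smul_right, hσN,
      (hN.isComplexTangent_iff hΩ hp L).1 hL]
    simp
  have hvn : ‖v‖ ≤ c₂ * (d + δ) ^ (1 / (k : ℝ)) := by
    have h1 := norm_sub_le (w • L) ((δ : ℂ) • σ)
    rw [norm_smul, norm_smul, hL1, mul_one, Complex.norm_real, Real.norm_of_nonneg hδ.le] at h1
    have h2 : δ * ‖σ‖ ≤ δ * (2 * ε) := mul_le_mul_of_nonneg_left hσε hδ.le
    have h3 : δ ^ (1 / (k : ℝ)) ≤ (d + δ) ^ (1 / (k : ℝ)) :=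
      Real.rpow_le_rpow hδ.le (by linarith) (by positivity)
    have h4 := mul_le_mul_of_nonneg_left h3 hc₂.le
    linarith
  have hw₁ : ‖(δ : ℂ) * b‖ ≤ c₁ * (d + δ) := by
    rw [norm_mul, Complex.norm_real, Real.norm_of_nonneg hδ.le]
    nlinarith [mul_le_mul_of_nonneg_left (hbε.trans hε₁) hδ.le, mul_nonneg hc₁.le hd]
  obtain ⟨L', w', hL', hL'1, hw', hvw⟩ : ∃ (L' : EuclideanSpace ℂ (Fin n)) (w' : ℂ),
      inner ℂ N L' = 0 ∧ ‖L'‖ = 1 ∧ ‖w'‖ = ‖v‖ ∧ v = w' • L' := by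
    by_cases hv0 : v = 0
    · exact ⟨L, 0, (hN.isComplexTangent_iff hΩ hp L).1 hL, hL1, by simp [hv0], by simp [hv0]⟩
    · have hvn0 : ‖v‖ ≠ 0 := norm_ne_zero_iff.2 hv0
      refine ⟨((‖v‖⁻¹ : ℝ) : ℂ) • v, (‖v‖ : ℂ), ?_, ?_, by simp, ?_⟩
      · rw [inner_smul_right, hvN, mul_zero]
      · rw [norm_smul, Complex.norm_real, norm_inv, norm_norm, inv_mul_cancel₀ hvn0]
      · rw [smul_smul, ← Complex.ofReal_mul, mul_inv_cancel₀ hvn0]; simp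
  have := hdisc p hpS N L' hN ((hN.isComplexTangent_iff hΩ hp L').2 hL') hL'1 (d + δ)
    (by linarith) hdδ (δ * b) w' hw₁ (by rw [hw']; exact hvn)
  rw [← hvw] at this
  convert this using 1
  rw [hv, hσ]
  push_cast
  module

/-- A point of `Ω` lies on the inner normal through its nearest boundary point. -/
theorem IsNormalProjection.eq_sub_smul_normal {n : ℕ} {Ω V : Set (EuclideanSpace ℂ (Fin n))}
    (hΩ : IsOpen Ω) {π : EuclideanSpace ℂ (Fin n) → EuclideanSpace ℂ (Fin n)}
    (hπ : IsNormalProjection Ω V π) {z N : EuclideanSpace ℂ (Fin n)} (hz : z ∈ Ω) (hzV : z ∈ V)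
    (hN : IsUnitOutwardNormal Ω (π z) N) :
    z = π z - ((Metric.infDist z (frontier Ω) : ℝ) : ℂ) • N := by
  obtain ⟨hf, hd⟩ := hπ.2.2 z hzV
  rw [← hd]
  refine sub_eq_neg_infDist_smul_normal hΩ hf hN ?_ ?_
  · rw [dist_ne_zero]
    rintro h
    rw [← h, hΩ.frontier_eq] at hf
    exact hf.2 hz
  · rw [hd]
    exact ball_infDist_frontier_subset hΩ hz

/-! ### The Hölder estimate along the curve -/

theorem mainTheorem2 {n : ℕ} (hn : 2 ≤ n)
    (Ω : Set (EuclideanSpace ℂ (Fin n))) (hΩ_open : IsOpen Ω) (hΩ_conn : IsConnected Ω)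
    (hΩ_bdry : HasC1Boundary Ω)
    (U : Set (EuclideanSpace ℂ (Fin n)))
    (hU_open : ∃ O : Set (EuclideanSpace ℂ (Fin n)), IsOpen O ∧ U = O ∩ frontier Ω)
    (hU_compact : IsCompact (closure U))
    (k : ℕ) (hk : 1 ≤ k) (δ₀ c₁ c₂ : ℝ) (hdisc : UniformDiscPropertyWith Ω U k δ₀ c₁ c₂)
    (α : ℝ≥0) (hα_pos : 0 < α) (hα_lt : (α : ℝ) < 1 / (k : ℝ))
    (f : EuclideanSpace ℂ (Fin n) → ℂ) (hf_hol : DifferentiableOn ℂ f Ω)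
    (hf_lip : ∃ K : ℝ≥0, HolderOnWith K α f Ω) :
    ∃ C : ℝ, 0 < C ∧
      ∀ (V : Set (EuclideanSpace ℂ (Fin n)))
        (π : EuclideanSpace ℂ (Fin n) → EuclideanSpace ℂ (Fin n)), IsNormalProjection Ω V π →
      ∀ γ : ℝ → EuclideanSpace ℂ (Fin n), IsNormalizedComplexTangentialCurve Ω V π γ →
        (∀ t ∈ Icc (0 : ℝ) 1, Metric.infDist (γ t) (frontier Ω) ≤ δ₀ / 5) →
        (∀ t ∈ Icc (0 : ℝ) 1, π (γ t) ∈ U) →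
        ∀ s ∈ Icc (0 : ℝ) 1, ∀ t ∈ Icc (0 : ℝ) 1,
          ‖f (γ s) - f (γ t)‖ ≤ C * |s - t| ^ ((k : ℝ) * (α : ℝ)) := by
  obtain ⟨K, hK⟩ := hf_lip
  obtain ⟨ν, hνc, hν⟩ := hΩ_bdry.exists_continuousOn_normal hΩ_open
  have hUf : closure U ⊆ frontier Ω := by
    obtain ⟨O, -, rfl⟩ := hU_open
    exact closure_minimal inter_subset_right isClosed_frontier
  obtain ⟨hδ₀, hc₁, hc₂, -⟩ := id hdisc
  have hk0 : (0 : ℝ) < k := by exact_mod_cast hk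
  set κ : ℝ := 1 / (k : ℝ) with hκ
  have hkκ : (k : ℝ) * κ = 1 := by rw [hκ]; field_simp
  have hκ1 : κ ≤ 1 := by
    rw [hκ, div_le_one hk0]; exact_mod_cast hk
  have hα0 : (0 : ℝ) < α := hα_pos
  have hkα : (k : ℝ) * α < 1 := by
    rw [← hkκ]; exact mul_lt_mul_of_pos_left hα_lt hk0
  set M : ℝ := δ₀ ^ (1 - κ) with hM
  have hM0 : 0 < M := by positivity
  -- Tolerance for the normals: `c₁` bounds the normal error, and since `δ ≤ M * δ ^ κ` on `(0,
  -- δ₀]`, the other term keeps the tangential error within half the disc radius.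
  set ε : ℝ := min c₁ (c₂ / (4 * M)) with hε
  have hε0 : 0 < ε := by positivity
  have hε₂ : ∀ δ : ℝ, 0 < δ → δ ≤ δ₀ → 2 * ε * δ ≤ c₂ / 2 * δ ^ κ := by
    intro δ h0 h1
    have e1 : δ = δ ^ (1 - κ) * δ ^ κ := by
      rw [← Real.rpow_add h0]; simp
    have e2 : δ ^ (1 - κ) ≤ M := Real.rpow_le_rpow h0.le h1 (by linarith)
    have e3 : ε * (4 * M) ≤ c₂ := by
      rw [← le_div_iff₀ (by positivity)]; exact min_le_right _ _
    calc 2 * ε * δ = 2 * ε * (δ ^ (1 - κ) * δ ^ κ) := by rw [← e1]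
      _ ≤ 2 * ε * (M * δ ^ κ) := by gcongr
      _ = ε * (4 * M) / 2 * δ ^ κ := by ring
      _ ≤ c₂ / 2 * δ ^ κ := by gcongr
  obtain ⟨ρ, hρ0, hρ⟩ := Metric.uniformContinuousOn_iff.1
    (hU_compact.uniformContinuousOn_of_continuous (hνc.mono hUf)) ε hε0
  -- If `γ t` is within `η` of the boundary and `h ≤ η / 2`, the two projections are at most `2 * η
  -- + 2 * h ≤ 3 * η < ρ` apart.
  set η : ℝ := ρ / 4 with hη
  have hη0 : 0 < η := by positivity
  set h₀ : ℝ := min (η / 2) (min 1 (δ₀ / 2)) with hh₀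
  have hh₀0 : 0 < h₀ := by positivity
  have hh₀η : h₀ ≤ η / 2 := min_le_left _ _
  have hh₀1 : h₀ ≤ 1 := (min_le_right _ _).trans (min_le_left _ _)
  have hh₀δ : h₀ ≤ δ₀ / 2 := (min_le_right _ _).trans (min_le_right _ _)
  obtain ⟨A, hA0, hA⟩ := norm_deriv_line_le_of_discs hΩ_open hf_hol hK (κ := κ) (D := δ₀ / 2)
    (c := c₂ / 2) (by positivity) (by positivity) hα_lt
  set C₁ : ℝ := K / h₀ ^ ((k : ℝ) * α) with hC₁
  set C₃ : ℝ := K * (η / 4) ^ (α : ℝ) / (η / 4) with hC₃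
  have hC₁0 : 0 ≤ C₁ := by positivity
  have hC₃0 : 0 ≤ C₃ := by positivity
  have hK0 : (0 : ℝ) ≤ K := K.2
  refine ⟨C₁ + (2 * K + A) + C₃ + 1, by positivity, ?_⟩
  intro V π hπ γ ⟨hγ, hγt⟩ hγd hγU s hs t ht
  rcases eq_or_ne s t with rfl | hst
  · simp only [sub_self, norm_zero]; positivity
  set h : ℝ := |s - t| with hh
  have hh0 : 0 < h := abs_pos.2 (sub_ne_zero.2 hst)
  have hh1 : h ≤ 1 := by
    rw [hh, abs_le]; constructor <;> linarith [hs.1, hs.2, ht.1, ht.2]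
  have hX : 0 < h ^ ((k : ℝ) * α) := by positivity
  have hcurve : ∀ x ∈ Icc (0 : ℝ) 1, ∀ y ∈ Icc (0 : ℝ) 1, ‖γ x - γ y‖ ≤ |x - y| :=
    fun x hx y hy => norm_curve_sub_le hγ (fun t ht => (hγt t ht).2.2.2) hx hy
  have hsub : uIcc s t ⊆ Icc 0 1 := uIcc_subset_Icc hs ht
  have hxt : ∀ x ∈ uIcc s t, |x - t| ≤ h := fun x hx => by
    rw [hh, abs_sub_comm x t, abs_sub_comm s t]
    exact abs_sub_right_of_mem_uIcc hx
  suffices hsuff : ‖f (γ s) - f (γ t)‖ ≤ C₁ * h ^ ((k : ℝ) * α) ∨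
      ‖f (γ s) - f (γ t)‖ ≤ (2 * K + A) * h ^ ((k : ℝ) * α) ∨
      ‖f (γ s) - f (γ t)‖ ≤ C₃ * h ^ ((k : ℝ) * α) by
    have p1 : 0 ≤ C₁ * h ^ ((k : ℝ) * α) := by positivity
    have p2 : 0 ≤ (2 * K + A) * h ^ ((k : ℝ) * α) := by positivity
    have p3 : 0 ≤ C₃ * h ^ ((k : ℝ) * α) := by positivity
    simp only [add_mul] at p2 hsuff ⊢
    rcases hsuff with h1 | h1 | h1 <;> linarith
  rcases lt_or_ge h₀ h with hbig | hsmall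
  · left
    have h1 := hK.norm_sub_le' (hγt s hs).1 (hγt t ht).1 (hcurve s hs t ht)
    have h2 : h ^ (α : ℝ) ≤ 1 := Real.rpow_le_one hh0.le hh1 hα0.le
    have h3 : h₀ ^ ((k : ℝ) * α) ≤ h ^ ((k : ℝ) * α) :=
      Real.rpow_le_rpow hh₀0.le hbig.le (by positivity)
    calc ‖f (γ s) - f (γ t)‖ ≤ K * h ^ (α : ℝ) := h1
      _ ≤ K * 1 := by gcongr
      _ = C₁ * h₀ ^ ((k : ℝ) * α) := by rw [hC₁]; field_simp
      _ ≤ C₁ * h ^ ((k : ℝ) * α) := by gcongr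
  right
  have hdist : ∀ x ∈ uIcc s t, |Metric.infDist (γ x) (frontier Ω) -
      Metric.infDist (γ t) (frontier Ω)| ≤ h := fun x hx => by
    have := (Metric.lipschitz_infDist_pt (frontier Ω)).dist_le_mul (γ x) (γ t)
    rw [Real.dist_eq, NNReal.coe_one, one_mul, dist_eq_norm] at this
    exact this.trans ((hcurve x (hsub hx) t ht).trans (hxt x hx))
  rcases le_or_gt (Metric.infDist (γ t) (frontier Ω)) η with hnear | hfar
  · left
    -- This depth balances the two costs: `δ ^ α` and `δ ^ (α - κ) * h` both equal `h ^ (kα)`.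
    set δ : ℝ := h ^ k with hδ
    have hδ0 : 0 < δ := by positivity
    have hδD : δ ≤ δ₀ / 2 :=
      (pow_le_of_le_one hh0.le hh1 (by omega)).trans (hsmall.trans hh₀δ)
    have hδα : δ ^ (α : ℝ) = h ^ ((k : ℝ) * α) := by
      rw [hδ, ← Real.rpow_natCast, ← Real.rpow_mul hh0.le]
    have hδh : δ ^ ((α : ℝ) - κ) * h = h ^ ((k : ℝ) * α) := by
      rw [hδ, ← Real.rpow_natCast, ← Real.rpow_mul hh0.le]
      nth_rewrite 2 [← Real.rpow_one h]
      rw [← Real.rpow_add hh0]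
      congr 1
      linear_combination -hkκ
    set N₀ := ν (π (γ t)) with hN₀
    have hN₀1 : ‖N₀‖ = 1 := (hν _ (hUf (subset_closure (hγU t ht)))).1
    have hin : ∀ x ∈ uIcc s t, ∀ δ' : ℝ, 0 < δ' → δ' ≤ δ₀ / 2 → ∀ w : ℂ,
        ‖w‖ ≤ c₂ / 2 * δ' ^ κ →
        γ x - (δ' : ℂ) • N₀ + w • derivWithin γ (Icc 0 1) x ∈ Ω := by
      intro x hx δ' h0 h1 w hw
      have hx1 := hsub hx
      obtain ⟨hxΩ, hxV, hxT, hxn⟩ := hγt x hx1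
      have hpU := hγU x hx1
      have hpf := hUf (subset_closure hpU)
      have hd0 : 0 ≤ Metric.infDist (γ x) (frontier Ω) := Metric.infDist_nonneg
      have hclose : dist (π (γ t)) (π (γ x)) < ρ := by
        have a1 := (hπ.2.2 _ hxV).2
        have a2 := (hπ.2.2 _ (hγt t ht).2.1).2
        have a3 := dist_triangle4 (π (γ t)) (γ t) (γ x) (π (γ x))
        have a4 := (hcurve x hx1 t ht).trans (hxt x hx)
        rw [← dist_eq_norm, dist_comm] at a4
        rw [dist_comm (π (γ t)) (γ t)] at a3
        have a5 := (abs_le.1 (hdist x hx)).2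
        linarith
      have hNε : ‖N₀ - ν (π (γ x))‖ ≤ ε := by
        rw [← dist_eq_norm]
        exact (hρ _ (subset_closure (hγU t ht)) _ (subset_closure hpU) hclose).le
      have hpt := hπ.eq_sub_smul_normal hΩ_open hxΩ hxV (hν _ hpf)
      -- The total depth is at most `δ₀ / 5 + δ₀ / 2 ≤ δ₀`.
      have := hdisc.mem_of_near_normal hΩ_open hpU hpf (hν _ hpf) hxT hxn hNε (min_le_left _ _)
        hd0 h0 (by linarith [hγd x hx1]) (hε₂ δ' h0 (by linarith)) hw
      rwa [← hpt] at this
    have hin0 : ∀ x ∈ uIcc s t, γ x - (δ : ℂ) • N₀ ∈ Ω := fun x hx => by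
      simpa using hin x hx δ hδ0 hδD 0 (by simp only [norm_zero]; positivity)
    have hmv := norm_comp_curve_sub_le hΩ_open hf_hol hγ ((δ : ℂ) • N₀) hs ht hin0
      (B := A * δ ^ ((α : ℝ) - κ)) fun x hx =>
        hA (γ x) N₀ _ (hγt x (hsub hx)).2.2.2 hN₀1 (hin x hx) δ hδ0 hδD
    rw [← hh, mul_assoc, hδh] at hmv
    have hpush : ∀ x ∈ uIcc s t,
        ‖f (γ x) - f (γ x - (δ : ℂ) • N₀)‖ ≤ K * h ^ ((k : ℝ) * α) := fun x hx => by
      rw [← hδα]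
      apply hK.norm_sub_le' (hγt x (hsub hx)).1 (hin0 x hx)
      rw [sub_sub_cancel, norm_smul, hN₀1, Complex.norm_real, Real.norm_of_nonneg hδ0.le, mul_one]
    have p1 := hpush s left_mem_uIcc
    have p2 := hpush t right_mem_uIcc
    rw [norm_sub_rev] at p2
    calc ‖f (γ s) - f (γ t)‖ = ‖(f (γ s) - f (γ s - (δ : ℂ) • N₀)) +
          (f (γ s - (δ : ℂ) • N₀) - f (γ t - (δ : ℂ) • N₀)) +
          (f (γ t - (δ : ℂ) • N₀) - f (γ t))‖ := by congr 1; ring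
      _ ≤ _ := norm_add₃_le
      _ ≤ (2 * K + A) * h ^ ((k : ℝ) * α) := by linarith
  -- Far from the boundary: the arc stays at distance greater than `η / 2`, so fixed discs of radius
  -- `η / 4` give a Lipschitz bound, and `h ≤ h ^ (kα)` because `kα < 1`.
  · right
    have hin : ∀ x ∈ uIcc s t, ∀ w : ℂ, ‖w‖ ≤ η / 4 →
        γ x - 0 + w • derivWithin γ (Icc 0 1) x ∈ Ω := by
      intro x hx w hw
      apply ball_infDist_frontier_subset hΩ_open (hγt x (hsub hx)).1
      rw [Metric.mem_ball, dist_eq_norm, sub_zero, add_sub_cancel_left, norm_smul,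
        (hγt x (hsub hx)).2.2.2, mul_one]
      have := (abs_le.1 (hdist x hx)).1
      linarith
    have hmv := norm_comp_curve_sub_le hΩ_open hf_hol hγ 0 hs ht
      (fun x hx => by simpa using (hγt x (hsub hx)).1) (B := C₃) fun x hx =>
        norm_deriv_line_le_of_holder hΩ_open hf_hol hK (hγt x (hsub hx)).2.2.2
          (by positivity) (hin x hx)
    rw [sub_zero, sub_zero] at hmv
    refine hmv.trans (mul_le_mul_of_nonneg_left ?_ hC₃0)
    nth_rewrite 1 [← Real.rpow_one |s - t|]
    exact Real.rpow_le_rpow_of_exponent_ge hh0 hh1 hkα.le
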